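/- Let $A\in\mathbb R^{n\times n}$, $B\in\mathbb R^{n\times m}$, $Q,Q_f\in\mathbb R^{n\times n}$ symmetric positive semidefinite and $R\in\mathbb R^{m\times m}$ symmetric positive definite, with $(A,B)$ and $(A^\top,Q)$ stabilizable (a pair $(A,B)$ is stabilizable if $\rho(A-BK_0)<1$ for some matrix $K_0$). Let $P\succeq 0$ be the positive semidefinite solution of $P=Q+A^\top PA-A^\top PB(R+B^\top PB)^{-1}B^\top PA$, and put $$F=A-B(R+B^\top PB)^{-1}B^\top PA,\qquad H=B(R+B^\top PB)^{-1}B^\top .$$ Assume that $P$ is invertible and that $\lambda:=\lambda_{\min}(P^{-1}-FP^{-1}F^\top-H)>0$, so that the quantities below are defined and finite. Put $c=\|P\|\,\|P^{-1}\|\,(1+\|F\|)$. Here $\|\cdot\|$ is the Euclidean norm of a vector or the spectral norm of a matrix. For an initial state $x_0\in\mathbb R^n$, a horizon $T$ and disturbances $w_0,\dots,w_{T-1}\in\mathbb R^n$, controls $u_0,\dots,u_{T-1}\in\mathbb R^m$ produce the states $x_{t+1}=Ax_t+Bu_t+w_t$ and have the cost $J=\sum_{t=0}^{T-1}(x_t^\top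 Qx_t+u_t^\top Ru_t)+x_T^\top Q_fx_T$. Let $\mathrm{Opt}=\inf_u J$ be the optimal offline cost for these disturbances. Fix a delay $d\ge 0$, a number $k\ge 0$ of used predictions and numbers $\epsilon_i\ge 0$ $(i\ge 0)$. At time $t$ the controller knows $x_0,\dots,x_{\max(t-d,0)}$, $u_0,\dots,u_{t-1}$, and predictions $\hat w_{s|t}$ of $w_s$ for $\max(t-d,0)\le s\le T-1$, which satisfy $\|w_s-\hat w_{s|t}\|\le\epsilon_{s-t+d}\,\|w_s\|$. Define the state estimates at time $t$ by $\hat x_{s|t}=x_s$ for $s\le\max(t-d,0)$ and $\hat x_{s+1|t}=A\hat x_{s|t}+Bu_s+\hat w_{s|t}$ for $s\ge\max(t-d,0)$. The myopic predictive policy applies, for $k\ge d$, $$u_t=-(R+B^\top PB)^{-1}B^\top\Big(PA\hat x_{t|t}+\sum_{0\le i<k-d,\ t+i<T}(F^\top)^iP\hat w_{t+i|t}\Big),$$ and, for $k<d$, with $j=\min(d-k,t)$, $$u_t=-(R+B^\top PB)^{-1}B^\top PA\Big(A^{j}\hat x_{t-j|t}+\sum_{i=0}^{j-1}A^iBu_{t-1-i}\Big).$$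 Let $\mathrm{Alg}$ be its cost $J$. Theorem. For every $r$ there is a constant $\kappa$, which may depend on $A,B,Q,R,Q_f,r,x_0,d,k$ and $(\epsilon_i)_i$ but not on $T$, the disturbances or the predictions, and which is $0$ when $Q_f=P$, such that for all $T$, all disturbances with $\|w_t\|\le r$ for $0\le t<T$, and all predictions as above: if $k\ge d$, then $$\mathrm{Alg}\le\left[\frac{\|H\|}{\lambda}\Big(c\sum_{i=0}^{d-1}\epsilon_i\|A^{d-i}\|+c\sum_{i=d}^{k-1}\epsilon_i\|F^{i-d}\|+\|F^{k-d}\|\Big)^2+1\right]\mathrm{Opt}+\kappa,$$ and if $k\le d$, then $$\mathrm{Alg}\le\left[\frac{\|H\|}{\lambda}\Big(c\sum_{i=0}^{k-1}\epsilon_i\|A^{d-i}\|+c\sum_{i=k}^{d-1}\|A^{d-i}\|+1\Big)^2+1\right]\mathrm{Opt}+\kappa .$$ -/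

import Mathlib

open Matrix Finset
open scoped Matrix.Norms.L2Operator

namespace DelayedLQR

noncomputable section

variable {n m : ℕ}

/-- The spectral radius of a real square matrix is less than one (complex eigenvalues count). -/
def IsSchurStable (M : Matrix (Fin n) (Fin n) ℝ) : Prop :=
  spectralRadius ℂ (M.map Complex.ofReal) < 1

/-- The pair `(A, B)` is stabilizable: `ρ(A - B K₀) < 1` for some `K₀`. -/
def Stabilizable {p : ℕ} (A : Matrix (Fin n) (Fin n) ℝ) (B : Matrix (Fin n) (Fin p) ℝ) : Prop :=
  ∃ K₀ : Matrix (Fin p) (Fin n) ℝ, IsSchurStable (A - B * K₀)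

/-- `P` is the positive semidefinite solution of the discrete algebraic Riccati equation. -/
structure IsDARESolution (A : Matrix (Fin n) (Fin n) ℝ) (B : Matrix (Fin n) (Fin m) ℝ)
    (Q : Matrix (Fin n) (Fin n) ℝ) (R : Matrix (Fin m) (Fin m) ℝ)
    (P : Matrix (Fin n) (Fin n) ℝ) : Prop where
  posSemidef : P.PosSemidef
  riccati : P = Q + Aᵀ * P * A - Aᵀ * P * B * (R + Bᵀ * P * B)⁻¹ * Bᵀ * P * A

/-- `F = A - B (R + Bᵀ P B)⁻¹ Bᵀ P A`. -/
def closedLoop (A : Matrix (Fin n) (Fin n) ℝ) (B : Matrix (Fin n) (Fin m) ℝ)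
    (R : Matrix (Fin m) (Fin m) ℝ) (P : Matrix (Fin n) (Fin n) ℝ) : Matrix (Fin n) (Fin n) ℝ :=
  A - B * (R + Bᵀ * P * B)⁻¹ * Bᵀ * P * A

/-- `H = B (R + Bᵀ P B)⁻¹ Bᵀ`. -/
def gainH (B : Matrix (Fin n) (Fin m) ℝ) (R : Matrix (Fin m) (Fin m) ℝ)
    (P : Matrix (Fin n) (Fin n) ℝ) : Matrix (Fin n) (Fin n) ℝ :=
  B * (R + Bᵀ * P * B)⁻¹ * Bᵀ

/-- The smallest eigenvalue of a real symmetric matrix. -/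
def lambdaMin (M : Matrix (Fin n) (Fin n) ℝ) : ℝ := sInf (spectrum ℝ M)

/-- The state trajectory `x_{t+1} = A x_t + B u_t + w_t` started at `x₀`. -/
def traj (A : Matrix (Fin n) (Fin n) ℝ) (B : Matrix (Fin n) (Fin m) ℝ) (x₀ : Fin n → ℝ)
    (w : ℕ → Fin n → ℝ) (u : ℕ → Fin m → ℝ) : ℕ → Fin n → ℝ
  | 0 => x₀
  | t + 1 => A *ᵥ traj A B x₀ w u t + B *ᵥ u t + w t

/-- The cost `∑_{t<T} (x_tᵀ Q x_t + u_tᵀ R u_t) + x_Tᵀ Qf x_T` of the controls `u`. -/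
def cost (A : Matrix (Fin n) (Fin n) ℝ) (B : Matrix (Fin n) (Fin m) ℝ)
    (Q : Matrix (Fin n) (Fin n) ℝ) (R : Matrix (Fin m) (Fin m) ℝ) (Qf : Matrix (Fin n) (Fin n) ℝ)
    (x₀ : Fin n → ℝ) (T : ℕ) (w : ℕ → Fin n → ℝ) (u : ℕ → Fin m → ℝ) : ℝ :=
  ∑ t ∈ range T, (traj A B x₀ w u t ⬝ᵥ Q *ᵥ traj A B x₀ w u t + u t ⬝ᵥ R *ᵥ u t)
    + traj A B x₀ w u T ⬝ᵥ Qf *ᵥ traj A B x₀ w u T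

/-- The offline optimal cost, with full knowledge of the disturbances. -/
def optCost (A : Matrix (Fin n) (Fin n) ℝ) (B : Matrix (Fin n) (Fin m) ℝ)
    (Q : Matrix (Fin n) (Fin n) ℝ) (R : Matrix (Fin m) (Fin m) ℝ) (Qf : Matrix (Fin n) (Fin n) ℝ)
    (x₀ : Fin n → ℝ) (T : ℕ) (w : ℕ → Fin n → ℝ) : ℝ :=
  ⨅ u : ℕ → Fin m → ℝ, cost A B Q R Qf x₀ T w u

/-- The estimate `x̂_{s|t}` of `x_s` made at time `t`: the observed state `x_s` for
`s ≤ max (t - d) 0`, and from there on the dynamics driven by the applied controls and the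
predictions `v s = ŵ_{s|t}`. -/
def stateEstimate (A : Matrix (Fin n) (Fin n) ℝ) (B : Matrix (Fin n) (Fin m) ℝ) (d t : ℕ)
    (x : ℕ → Fin n → ℝ) (u : ℕ → Fin m → ℝ) (v : ℕ → Fin n → ℝ) : ℕ → Fin n → ℝ
  | 0 => x 0
  | s + 1 =>
    if s + 1 ≤ t - d then x (s + 1)
    else A *ᵥ stateEstimate A B d t x u v s + B *ᵥ u s + v s

/-- The action `u_t` of the myopic predictive policy with delay `d` and `k` predictions, given the
past states `x`, the past controls `u` and the predictions `v s = ŵ_{s|t}`.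
Predictions exist for `s < T` only, so the sum in the case `d ≤ k` stops there.
In the case `k < d` the number `min (d - k) t` is `d - k` except at the first steps `t < d - k`,
where the propagation starts at the known state `x_0`. -/
def myopicAction (A : Matrix (Fin n) (Fin n) ℝ) (B : Matrix (Fin n) (Fin m) ℝ)
    (R : Matrix (Fin m) (Fin m) ℝ) (P : Matrix (Fin n) (Fin n) ℝ) (d k T t : ℕ)
    (x : ℕ → Fin n → ℝ) (u : ℕ → Fin m → ℝ) (v : ℕ → Fin n → ℝ) : Fin m → ℝ :=
  if d ≤ k then
    -(((R + Bᵀ * P * B)⁻¹ * Bᵀ) *ᵥ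
      ((P * A) *ᵥ stateEstimate A B d t x u v t
        + ∑ i ∈ range (min (k - d) (T - t)), ((closedLoop A B R P)ᵀ ^ i * P) *ᵥ v (t + i)))
  else
    -(((R + Bᵀ * P * B)⁻¹ * Bᵀ * P * A) *ᵥ
      (A ^ min (d - k) t *ᵥ stateEstimate A B d t x u v (t - min (d - k) t)
        + ∑ i ∈ range (min (d - k) t), (A ^ i * B) *ᵥ u (t - 1 - i)))

/-- The controls produced by the myopic predictive policy in closed loop, when the disturbances are
`w` and the prediction of `w s` at time `t` is `what s t`. -/
def myopicControl (A : Matrix (Fin n) (Fin n) ℝ) (B : Matrix (Fin n) (Fin m) ℝ)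
    (R : Matrix (Fin m) (Fin m) ℝ) (P : Matrix (Fin n) (Fin n) ℝ) (d k T : ℕ) (x₀ : Fin n → ℝ)
    (w : ℕ → Fin n → ℝ) (what : ℕ → ℕ → Fin n → ℝ) (t : ℕ) : Fin m → ℝ :=
  let past : ℕ → Fin m → ℝ := fun s =>
    if _h : s < t then myopicControl A B R P d k T x₀ w what s else 0
  myopicAction A B R P d k T t (traj A B x₀ w past) past (fun s => what s t)
termination_by t

/-- The cost of the myopic predictive policy. -/
def algCost (A : Matrix (Fin n) (Fin n) ℝ) (B : Matrix (Fin n) (Fin m) ℝ)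
    (Q : Matrix (Fin n) (Fin n) ℝ) (R : Matrix (Fin m) (Fin m) ℝ) (Qf : Matrix (Fin n) (Fin n) ℝ)
    (P : Matrix (Fin n) (Fin n) ℝ) (d k : ℕ) (x₀ : Fin n → ℝ) (T : ℕ)
    (w : ℕ → Fin n → ℝ) (what : ℕ → ℕ → Fin n → ℝ) : ℝ :=
  cost A B Q R Qf x₀ T w (myopicControl A B R P d k T x₀ w what)

/-- Every prediction `what s t` of `w s` made at time `t`, that is `i = s - (t - d)` steps into the
unknown, has an error of at most `ε i * ‖w s‖` (Euclidean norms). -/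
def PredictionErrorBound (d T : ℕ) (ε : ℕ → ℝ) (w : ℕ → Fin n → ℝ)
    (what : ℕ → ℕ → Fin n → ℝ) : Prop :=
  ∀ t < T, ∀ s < T, t ≤ s + d →
    ‖WithLp.toLp 2 (w s - what s t)‖ ≤ ε (s + d - t) * ‖WithLp.toLp 2 (w s)‖

end

end DelayedLQR

/-! Write `S = R + Bᵀ P B`, `D = P⁻¹ - F P⁻¹ Fᵀ - H` and `v_t = ∑ (Fᵀ)ⁱ P w_{t+i}`. For terminal
weight `P`, completing the square along the trajectory makes the cost of any controls equal to a
control-free value plus `∑ δ_tᵀ S δ_t`, where `δ_t = u_t + S⁻¹ Bᵀ (P A x_t + v_t)`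
(`cost_eq_offlineValue_add`). The value contains `∑ v_tᵀ D v_t`, so it is at least `λ ∑ ‖v_t‖²`.

The policy has `δ_t = S⁻¹ Bᵀ φ_t`, which costs `φ_tᵀ H φ_t ≤ ‖H‖ ‖φ_t‖²`. Here `φ_t` collects wrong
estimates of past disturbances, wrong predictions of future ones, and the unused tail of `v_t`.
Since `w_t = P⁻¹ (v_t - Fᵀ v_{t+1})`, Minkowski's inequality bounds `∑ ‖φ_t‖²` by `β² ∑ ‖v_t‖²`,
with `β` the bracket of the theorem (`sum_errorBound_sq_le`). Dividing by `λ` gives the ratio.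

For `Qf ≠ P`, positivity of `D` is a Lyapunov inequality that makes `F` stable, so the policy's
terminal state is bounded uniformly in `T`. A competitor's need not be, but moving the state away
from the `P`-optimal trajectory costs more than the terminal `P`-weight it could save
(`arrival_cost`). Both corrections go into `κ`. -/

namespace DelayedLQR

/-- The Euclidean norm of a vector. -/
noncomputable def euNorm {n : ℕ} (x : Fin n → ℝ) : ℝ := ‖WithLp.toLp 2 x‖

/-! ### Euclidean norms and quadratic forms. -/

section EuclideanNorm

variable {n m : ℕ}

lemma euNorm_nonneg (x : Fin n → ℝ) : 0 ≤ euNorm x := norm_nonneg _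

@[simp] lemma euNorm_zero : euNorm (0 : Fin n → ℝ) = 0 := by simp [euNorm]

lemma euNorm_add_le (x y : Fin n → ℝ) : euNorm (x + y) ≤ euNorm x + euNorm y := by
  simpa [euNorm] using norm_add_le (WithLp.toLp 2 x) (WithLp.toLp 2 y)

lemma euNorm_sub_le (x y : Fin n → ℝ) : euNorm (x - y) ≤ euNorm x + euNorm y := by
  simpa [euNorm] using norm_sub_le (WithLp.toLp 2 x) (WithLp.toLp 2 y)

lemma euNorm_sum_le {ι : Type*} (s : Finset ι) (f : ι → Fin n → ℝ) :
    euNorm (∑ i ∈ s, f i) ≤ ∑ i ∈ s, euNorm (f i) := by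
  simpa [euNorm, WithLp.toLp_sum] using norm_sum_le s fun i => WithLp.toLp 2 (f i)

lemma euNorm_sq (x : Fin n → ℝ) : euNorm x ^ 2 = x ⬝ᵥ x := by
  rw [euNorm, EuclideanSpace.real_norm_sq_eq]
  simp [dotProduct, sq]

lemma dotProduct_le_euNorm (x y : Fin n → ℝ) : x ⬝ᵥ y ≤ euNorm x * euNorm y := by
  have h := real_inner_le_norm (WithLp.toLp 2 x) (WithLp.toLp 2 y)
  simpa [euNorm, EuclideanSpace.inner_toLp_toLp, dotProduct_comm] using h

lemma euNorm_mulVec_le (M : Matrix (Fin m) (Fin n) ℝ) (x : Fin n → ℝ) :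
    euNorm (M *ᵥ x) ≤ ‖M‖ * euNorm x := by
  simpa [euNorm] using M.l2_opNorm_mulVec (WithLp.toLp 2 x)

lemma dotProduct_mulVec_le (M : Matrix (Fin n) (Fin n) ℝ) (x : Fin n → ℝ) :
    x ⬝ᵥ M *ᵥ x ≤ ‖M‖ * euNorm x ^ 2 := by
  calc x ⬝ᵥ M *ᵥ x ≤ euNorm x * euNorm (M *ᵥ x) := dotProduct_le_euNorm _ _
    _ ≤ euNorm x * (‖M‖ * euNorm x) := by
        gcongr
        · exact euNorm_nonneg _
        · exact euNorm_mulVec_le _ _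
    _ = _ := by ring

lemma norm_le_of_euNorm_mulVec_le (M : Matrix (Fin m) (Fin n) ℝ) {C : ℝ} (hC : 0 ≤ C)
    (h : ∀ x, euNorm (M *ᵥ x) ≤ C * euNorm x) : ‖M‖ ≤ C := by
  rw [Matrix.l2_opNorm_def]
  refine ContinuousLinearMap.opNorm_le_bound _ hC fun x => ?_
  exact h (WithLp.ofLp x)

lemma norm_transpose (M : Matrix (Fin m) (Fin n) ℝ) : ‖Mᵀ‖ = ‖M‖ := by
  rw [← conjTranspose_eq_transpose_of_trivial, l2_opNorm_conjTranspose]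

lemma mulVec_dotProduct (M : Matrix (Fin m) (Fin n) ℝ) (x : Fin n → ℝ) (y : Fin m → ℝ) :
    M *ᵥ x ⬝ᵥ y = x ⬝ᵥ Mᵀ *ᵥ y := by
  rw [dotProduct_mulVec, vecMul_transpose]

lemma _root_.Matrix.PosSemidef.dot_nonneg {M : Matrix (Fin n) (Fin n) ℝ} (hM : M.PosSemidef)
    (x : Fin n → ℝ) : 0 ≤ x ⬝ᵥ M *ᵥ x := by
  simpa using hM.dotProduct_mulVec_nonneg x

lemma _root_.Matrix.PosSemidef.transpose_eq {M : Matrix (Fin n) (Fin n) ℝ}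
    (hM : M.PosSemidef) : Mᵀ = M := by
  simpa using hM.isHermitian.eq

/-- For a symmetric `M`, `λ_min(M) ‖x‖² ≤ xᵀ M x`. -/
lemma lambdaMin_mul_le {M : Matrix (Fin n) (Fin n) ℝ} (hM : M.IsHermitian) (x : Fin n → ℝ) :
    lambdaMin M * euNorm x ^ 2 ≤ x ⬝ᵥ M *ᵥ x := by
  have hbdd : BddBelow (spectrum ℝ M) := by
    rw [hM.spectrum_real_eq_range_eigenvalues]
    exact (Set.finite_range _).bddBelow
  have hpsd : (M - algebraMap ℝ _ (lambdaMin M)).PosSemidef := by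
    rw [posSemidef_iff_isHermitian_and_spectrum_nonneg]
    refine ⟨hM.sub ?_, ?_⟩
    · rw [Matrix.algebraMap_eq_diagonal]
      exact isHermitian_diagonal _
    · intro μ hμ
      rw [← spectrum.sub_singleton_eq, Set.mem_sub] at hμ
      obtain ⟨a, ha, b, hb, rfl⟩ := hμ
      rw [Set.mem_singleton_iff.1 hb]
      exact sub_nonneg.2 (csInf_le hbdd ha)
  have h := hpsd.dot_nonneg x
  rw [sub_mulVec, dotProduct_sub, Algebra.algebraMap_eq_smul_one, smul_mulVec, one_mulVec,
    dotProduct_smul, ← euNorm_sq, smul_eq_mul] at h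
  linarith

end EuclideanNorm

/-! ### Minkowski and shift inequalities for sums of squares. -/

section SumSquares

variable {T : ℕ} {V : ℝ}

/-- Minkowski's inequality relative to a common scale `V`, in squared form to avoid square roots. -/
lemma sum_sq_add_le {f g : ℕ → ℝ} {α β : ℝ} (hV : 0 ≤ V) (hα : 0 ≤ α) (hβ : 0 ≤ β)
    (hf : ∑ t ∈ range T, f t ^ 2 ≤ α ^ 2 * V) (hg : ∑ t ∈ range T, g t ^ 2 ≤ β ^ 2 * V) :
    ∑ t ∈ range T, (f t + g t) ^ 2 ≤ (α + β) ^ 2 * V := by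
  have hcs := sum_mul_sq_le_sq_mul_sq (range T) f g
  have hfg : ∑ t ∈ range T, f t * g t ≤ α * β * V := by
    refine le_of_sq_le_sq ?_ (by positivity)
    calc _ ≤ _ := hcs
      _ ≤ (α ^ 2 * V) * (β ^ 2 * V) := by
        gcongr
      _ = _ := by ring
  have hexp : ∑ t ∈ range T, (f t + g t) ^ 2 = ∑ t ∈ range T, f t ^ 2
      + 2 * ∑ t ∈ range T, f t * g t + ∑ t ∈ range T, g t ^ 2 := by
    rw [mul_sum, ← sum_add_distrib, ← sum_add_distrib]
    exact sum_congr rfl fun _ _ => by ring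
  rw [hexp]
  linarith

lemma sum_sq_mul_le {f : ℕ → ℝ} {α : ℝ} (a : ℝ) (hf : ∑ t ∈ range T, f t ^ 2 ≤ α ^ 2 * V) :
    ∑ t ∈ range T, (a * f t) ^ 2 ≤ (a * α) ^ 2 * V := by
  simp only [mul_pow, ← mul_sum]
  rw [mul_assoc]
  gcongr

lemma sum_sq_sum_le {f : ℕ → ℕ → ℝ} {α : ℕ → ℝ} (hV : 0 ≤ V) (hα : ∀ i, 0 ≤ α i) (K : ℕ)
    (hf : ∀ i, ∑ t ∈ range T, f i t ^ 2 ≤ α i ^ 2 * V) :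
    ∑ t ∈ range T, (∑ i ∈ range K, f i t) ^ 2 ≤ (∑ i ∈ range K, α i) ^ 2 * V := by
  induction K with
  | zero => simp
  | succ K ih =>
    simp only [sum_range_succ]
    exact sum_sq_add_le hV (sum_nonneg fun i _ => hα i) (hα K) ih (hf K)

/-- The shift `t ↦ t + i - d` is injective where `d ≤ t + i`, and what it pushes past the horizon
vanishes. Delays and advances are both covered. -/
lemma sum_shift_le {g : ℕ → ℝ} (hg : ∀ s, 0 ≤ g s) (hgT : ∀ s, T ≤ s → g s = 0) (d i : ℕ) :
    ∑ t ∈ range T, (if d ≤ t + i then g (t + i - d) else 0) ≤ ∑ s ∈ range T, g s := by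
  rw [← sum_filter]
  have hinj : Set.InjOn (fun t => t + i - d) ((range T).filter (d ≤ · + i) : Finset ℕ) := by
    intro a ha b hb hab
    simp only [coe_filter, Set.mem_ofPred_eq] at ha hb
    dsimp only at hab
    omega
  rw [← sum_image (f := g) hinj, ← sum_filter_add_sum_filter_not _ (· < T)]
  rw [sum_eq_zero (s := filter (fun x => ¬ x < T) _) fun s hs => hgT s (not_lt.1 (mem_filter.1 hs).2),
    add_zero]
  refine sum_le_sum_of_subset_of_nonneg (fun s hs => mem_range.2 (mem_filter.1 hs).2)
    fun s _ _ => hg s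

end SumSquares

/-! ### Stability of the closed loop. -/

section Stability

variable {n : ℕ}

/-- The discrete Lyapunov inequality `F N Fᵀ ≤ N - l` makes the powers of `F` summable. -/
lemma exists_sum_norm_pow_le {N F : Matrix (Fin n) (Fin n) ℝ} {l : ℝ} (hl : 0 < l)
    (hN : N.PosSemidef)
    (h : ∀ x, Fᵀ *ᵥ x ⬝ᵥ N *ᵥ Fᵀ *ᵥ x + l * euNorm x ^ 2 ≤ x ⬝ᵥ N *ᵥ x) :
    ∃ C : ℝ, 0 ≤ C ∧ ∀ T, ∑ i ∈ range T, ‖F ^ i‖ ≤ C := by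
  -- The contraction rate `1 - l / ‖N‖` is relaxed to this `q`, which lies in `[0, 1)` even when
  -- `‖N‖ = 0`.
  set q : ℝ := ‖N‖ / (‖N‖ + l) with hq
  have hden : 0 < ‖N‖ + l := by positivity
  have hq0 : 0 ≤ q := by positivity
  have hq1 : q < 1 := by rw [hq, div_lt_one hden]; linarith
  have hstep : ∀ x, Fᵀ *ᵥ x ⬝ᵥ N *ᵥ Fᵀ *ᵥ x ≤ q * (x ⬝ᵥ N *ᵥ x) := by
    intro x
    have h1 := h x
    have h2 := dotProduct_mulVec_le N x
    rw [hq, div_mul_eq_mul_div, le_div_iff₀ hden]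
    nlinarith [mul_le_mul_of_nonneg_left h1 (norm_nonneg N), mul_le_mul_of_nonneg_left h1 hl.le,
      mul_le_mul_of_nonneg_left h2 hl.le, mul_nonneg hl.le (mul_nonneg hl.le (sq_nonneg (euNorm x)))]
  have hpow : ∀ i x, (Fᵀ ^ i) *ᵥ x ⬝ᵥ N *ᵥ (Fᵀ ^ i) *ᵥ x ≤ q ^ i * (x ⬝ᵥ N *ᵥ x) := by
    intro i x
    induction i with
    | zero => simp
    | succ i ih =>
      rw [pow_succ' Fᵀ, ← mulVec_mulVec]
      calc _ ≤ _ := hstep _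
        _ ≤ q * (q ^ i * (x ⬝ᵥ N *ᵥ x)) := by gcongr
        _ = _ := by ring
  have hlow : ∀ x, l * euNorm x ^ 2 ≤ x ⬝ᵥ N *ᵥ x := fun x => by
    linarith [h x, hN.dot_nonneg (Fᵀ *ᵥ x)]
  have hnorm : ∀ i, ‖F ^ i‖ ≤ √(‖N‖ / l) * √q ^ i := by
    intro i
    rw [← norm_transpose, transpose_pow]
    refine norm_le_of_euNorm_mulVec_le _ (by positivity) fun x => ?_
    refine le_of_sq_le_sq ?_ (by have := euNorm_nonneg x; positivity)
    have h1 := hlow ((Fᵀ ^ i) *ᵥ x)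
    have h2 := hpow i x
    have h3 := mul_le_mul_of_nonneg_left (dotProduct_mulVec_le N x) (pow_nonneg hq0 i)
    rw [mul_pow, mul_pow, ← pow_mul, mul_comm i 2, pow_mul, Real.sq_sqrt hq0,
      Real.sq_sqrt (by positivity), div_mul_eq_mul_div, div_mul_eq_mul_div, le_div_iff₀ hl]
    linarith
  have hs1 : √q < 1 := by rw [Real.sqrt_lt' one_pos]; simpa using hq1
  have hsum : Summable fun i => √(‖N‖ / l) * √q ^ i :=
    (summable_geometric_of_lt_one (Real.sqrt_nonneg _) hs1).mul_left _
  refine ⟨∑' i, √(‖N‖ / l) * √q ^ i, tsum_nonneg fun i => by positivity, fun T => ?_⟩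
  exact (sum_le_sum fun i _ => hnorm i).trans
    (hsum.sum_le_tsum _ fun i _ => by positivity)

/-- Variation of constants. The bound does not involve `T`, which is what keeps `κ` independent of
the horizon. -/
lemma euNorm_recursion_le {F : Matrix (Fin n) (Fin n) ℝ} {C G : ℝ}
    (hC : ∀ T, ∑ i ∈ range T, ‖F ^ i‖ ≤ C) (hG : 0 ≤ G) {x g : ℕ → Fin n → ℝ} {T : ℕ}
    (hx : ∀ t < T, x (t + 1) = F *ᵥ x t + g t) (hg : ∀ t < T, euNorm (g t) ≤ G) :
    euNorm (x T) ≤ C * (euNorm (x 0) + G) := by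
  have hexp : ∀ t ≤ T, x t = (F ^ t) *ᵥ x 0 + ∑ i ∈ range t, (F ^ i) *ᵥ g (t - 1 - i) := by
    intro t ht
    induction t with
    | zero => simp
    | succ t ih =>
      rw [hx t ht, ih (by omega), mulVec_add, mulVec_mulVec, ← pow_succ', sum_range_succ',
        mulVec_sum, add_assoc]
      congr 2
      · refine sum_congr rfl fun i _ => ?_
        rw [mulVec_mulVec, ← pow_succ']
        congr 2
        omega
      · simp
  rw [hexp T le_rfl]
  have h1 : euNorm ((F ^ T) *ᵥ x 0) ≤ C * euNorm (x 0) := by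
    refine (euNorm_mulVec_le _ _).trans ?_
    gcongr
    · exact euNorm_nonneg _
    · exact (single_le_sum (f := fun i => ‖F ^ i‖) (fun i _ => norm_nonneg _)
        (self_mem_range_succ T)).trans (hC (T + 1))
  have h2 : euNorm (∑ i ∈ range T, (F ^ i) *ᵥ g (T - 1 - i)) ≤ C * G := by
    refine (euNorm_sum_le _ _).trans ?_
    calc _ ≤ ∑ i ∈ range T, ‖F ^ i‖ * G := by
          refine sum_le_sum fun i hi => (euNorm_mulVec_le _ _).trans ?_
          have := mem_range.1 hi
          gcongr
          exact hg _ (by omega)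
      _ = (∑ i ∈ range T, ‖F ^ i‖) * G := by rw [sum_mul]
      _ ≤ C * G := by gcongr; exact hC T
  calc _ ≤ _ := euNorm_add_le _ _
    _ ≤ _ := by linarith

end Stability

/-! ### The Riccati equation and completion of the square. -/

section Riccati

variable {n m : ℕ} {A : Matrix (Fin n) (Fin n) ℝ} {B : Matrix (Fin n) (Fin m) ℝ}
  {Q : Matrix (Fin n) (Fin n) ℝ} {R : Matrix (Fin m) (Fin m) ℝ} {P : Matrix (Fin n) (Fin n) ℝ}

lemma posDef_inputCost (hR : R.PosDef) (hP : P.PosDef) : (R + Bᵀ * P * B).PosDef := by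
  have h := hP.posSemidef.conjTranspose_mul_mul_same B
  rw [conjTranspose_eq_transpose_of_trivial] at h
  exact hR.add_posSemidef h

lemma posSemidef_gainH (hR : R.PosDef) (hP : P.PosDef) : (gainH B R P).PosSemidef := by
  have h := (posDef_inputCost (B := B) hR hP).inv.posSemidef.mul_mul_conjTranspose_same B
  rwa [conjTranspose_eq_transpose_of_trivial] at h

lemma closedLoop_mulVec (x : Fin n → ℝ) :
    closedLoop A B R P *ᵥ x = A *ᵥ x - gainH B R P *ᵥ P *ᵥ A *ᵥ x := by
  simp [closedLoop, gainH, sub_mulVec, mulVec_mulVec, Matrix.mul_assoc]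

lemma closedLoop_eq_add (x v w : Fin n → ℝ) (u : Fin m → ℝ) :
    A *ᵥ x + B *ᵥ u + w = closedLoop A B R P *ᵥ x + (w - gainH B R P *ᵥ v)
      + B *ᵥ (u + ((R + Bᵀ * P * B)⁻¹ * Bᵀ) *ᵥ (P *ᵥ A *ᵥ x + v)) := by
  rw [closedLoop_mulVec]
  simp only [gainH, mulVec_add, mulVec_mulVec, Matrix.mul_assoc]
  abel

/-- The symmetric matrix `P⁻¹ - F P⁻¹ Fᵀ - H` bounding the cost of the disturbances. -/
noncomputable def disturbanceForm (A : Matrix (Fin n) (Fin n) ℝ) (B : Matrix (Fin n) (Fin m) ℝ)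
    (R : Matrix (Fin m) (Fin m) ℝ) (P : Matrix (Fin n) (Fin n) ℝ) : Matrix (Fin n) (Fin n) ℝ :=
  P⁻¹ - closedLoop A B R P * P⁻¹ * (closedLoop A B R P)ᵀ - gainH B R P

lemma isHermitian_disturbanceForm (hR : R.PosDef) (hP : P.PosDef) :
    (disturbanceForm A B R P).IsHermitian := by
  refine (hP.inv.isHermitian.sub ?_).sub (posSemidef_gainH hR hP).isHermitian
  have h := hP.inv.posSemidef.mul_mul_conjTranspose_same (closedLoop A B R P)
  rw [conjTranspose_eq_transpose_of_trivial] at h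
  exact h.isHermitian

lemma disturbanceForm_apply (v : Fin n → ℝ) :
    v ⬝ᵥ disturbanceForm A B R P *ᵥ v = v ⬝ᵥ P⁻¹ *ᵥ v
      - (closedLoop A B R P)ᵀ *ᵥ v ⬝ᵥ P⁻¹ *ᵥ (closedLoop A B R P)ᵀ *ᵥ v
      - v ⬝ᵥ gainH B R P *ᵥ v := by
  rw [mulVec_dotProduct, transpose_transpose]
  simp only [disturbanceForm, sub_mulVec, dotProduct_sub, mulVec_mulVec, Matrix.mul_assoc]

lemma inv_mulVec_mulVec (hP : P.PosDef) (x : Fin n → ℝ) : P⁻¹ *ᵥ P *ᵥ x = x := by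
  rw [mulVec_mulVec, nonsing_inv_mul _ ((isUnit_iff_isUnit_det P).1 hP.isUnit), one_mulVec]

lemma mulVec_inv_mulVec (hP : P.PosDef) (x : Fin n → ℝ) : P *ᵥ P⁻¹ *ᵥ x = x := by
  rw [mulVec_mulVec, mul_nonsing_inv _ ((isUnit_iff_isUnit_det P).1 hP.isUnit), one_mulVec]

lemma symm_dot {M : Matrix (Fin n) (Fin n) ℝ} (hM : M.PosSemidef) (x y : Fin n → ℝ) :
    x ⬝ᵥ M *ᵥ y = y ⬝ᵥ M *ᵥ x := by
  rw [dotProduct_comm, mulVec_dotProduct, hM.transpose_eq]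

/-- For `δ = S⁻¹ Bᵀ g` one has `δᵀ S δ = gᵀ H g`. -/
lemma inputCost_gain (hR : R.PosDef) (hP : P.PosDef) (g : Fin n → ℝ) :
    ((R + Bᵀ * P * B)⁻¹ * Bᵀ) *ᵥ g ⬝ᵥ (R + Bᵀ * P * B) *ᵥ ((R + Bᵀ * P * B)⁻¹ * Bᵀ) *ᵥ g
      = g ⬝ᵥ gainH B R P *ᵥ g := by
  have hS := posDef_inputCost (B := B) hR hP
  rw [← mulVec_mulVec, mulVec_inv_mulVec hS, dotProduct_comm, mulVec_dotProduct]
  simp [gainH, mulVec_mulVec, Matrix.mul_assoc]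

/-- Completion of the square for one step of the value iteration. -/
lemma step_identity (hR : R.PosDef) (hP : P.PosDef)
    (hric : P = Q + Aᵀ * P * A - Aᵀ * P * B * (R + Bᵀ * P * B)⁻¹ * Bᵀ * P * A)
    (x v : Fin n → ℝ) (u δ : Fin m → ℝ)
    (hδ : δ = u + ((R + Bᵀ * P * B)⁻¹ * Bᵀ) *ᵥ (P *ᵥ A *ᵥ x + v)) :
    x ⬝ᵥ Q *ᵥ x + u ⬝ᵥ R *ᵥ u
        + (A *ᵥ x + B *ᵥ u + P⁻¹ *ᵥ v) ⬝ᵥ P *ᵥ (A *ᵥ x + B *ᵥ u + P⁻¹ *ᵥ v)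
      = (x + P⁻¹ *ᵥ (closedLoop A B R P)ᵀ *ᵥ v) ⬝ᵥ P *ᵥ (x + P⁻¹ *ᵥ (closedLoop A B R P)ᵀ *ᵥ v)
        + v ⬝ᵥ disturbanceForm A B R P *ᵥ v + δ ⬝ᵥ (R + Bᵀ * P * B) *ᵥ δ := by
  have hS := posDef_inputCost (B := B) hR hP
  have hH := posSemidef_gainH (B := B) hR hP
  have hPs := hP.posSemidef
  set F := closedLoop A B R P with hF
  set S := R + Bᵀ * P * B with hSdef
  set a := A *ᵥ x with ha
  set g := P *ᵥ a + v with hg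
  set h := (S⁻¹ * Bᵀ) *ᵥ g with hh
  -- Only `e1` uses the Riccati equation. The remaining relations reduce every term to pairings of
  -- `a`, `B *ᵥ u` and `v`, among which the claim is linear.
  have e1 : x ⬝ᵥ P *ᵥ x = x ⬝ᵥ Q *ᵥ x + a ⬝ᵥ P *ᵥ a - P *ᵥ a ⬝ᵥ gainH B R P *ᵥ P *ᵥ a := by
    conv_lhs => rw [hric]
    rw [mulVec_dotProduct P, hPs.transpose_eq, ha, mulVec_dotProduct, mulVec_dotProduct]
    simp only [gainH, sub_mulVec, add_mulVec, dotProduct_sub, dotProduct_add, mulVec_mulVec,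
      Matrix.mul_assoc]
    rw [hSdef]
    simp only [Matrix.mul_assoc]
  have e2 : F *ᵥ x = a - gainH B R P *ᵥ P *ᵥ a := closedLoop_mulVec x
  have e3 : x ⬝ᵥ Fᵀ *ᵥ v = a ⬝ᵥ v - P *ᵥ a ⬝ᵥ gainH B R P *ᵥ v := by
    rw [← mulVec_dotProduct, e2, sub_dotProduct, mulVec_dotProduct (gainH B R P),
      hH.transpose_eq]
  have e4 : S *ᵥ h = Bᵀ *ᵥ g := by
    rw [hh, ← mulVec_mulVec, mulVec_inv_mulVec hS]
  have e5 : h ⬝ᵥ S *ᵥ h = g ⬝ᵥ gainH B R P *ᵥ g := inputCost_gain hR hP g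
  have e6 : g ⬝ᵥ gainH B R P *ᵥ g = P *ᵥ a ⬝ᵥ gainH B R P *ᵥ P *ᵥ a
      + 2 * (P *ᵥ a ⬝ᵥ gainH B R P *ᵥ v) + v ⬝ᵥ gainH B R P *ᵥ v := by
    rw [hg]
    simp only [mulVec_add, dotProduct_add, add_dotProduct]
    rw [symm_dot hH v (P *ᵥ a)]
    ring
  have e7 : δ ⬝ᵥ S *ᵥ δ = u ⬝ᵥ S *ᵥ u + 2 * (B *ᵥ u ⬝ᵥ g) + h ⬝ᵥ S *ᵥ h := by
    rw [hδ]
    simp only [mulVec_add, dotProduct_add, add_dotProduct]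
    rw [symm_dot hS.posSemidef h u, e4, mulVec_dotProduct B]
    ring
  have e8 : u ⬝ᵥ S *ᵥ u = u ⬝ᵥ R *ᵥ u + B *ᵥ u ⬝ᵥ P *ᵥ B *ᵥ u := by
    rw [hSdef, add_mulVec, dotProduct_add, mulVec_dotProduct B]
    simp only [mulVec_mulVec, Matrix.mul_assoc]
  have e9 : B *ᵥ u ⬝ᵥ g = B *ᵥ u ⬝ᵥ P *ᵥ a + B *ᵥ u ⬝ᵥ v := by rw [hg, dotProduct_add]
  have e10 : P⁻¹ *ᵥ v ⬝ᵥ v = v ⬝ᵥ P⁻¹ *ᵥ v := dotProduct_comm _ _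
  have e11 : P⁻¹ *ᵥ Fᵀ *ᵥ v ⬝ᵥ Fᵀ *ᵥ v = Fᵀ *ᵥ v ⬝ᵥ P⁻¹ *ᵥ Fᵀ *ᵥ v := dotProduct_comm _ _
  have e12 : ∀ y z, P⁻¹ *ᵥ y ⬝ᵥ P *ᵥ z = z ⬝ᵥ y := fun y z => by
    rw [symm_dot hPs, mulVec_inv_mulVec hP]
  rw [disturbanceForm_apply]
  simp only [mulVec_add, dotProduct_add, add_dotProduct, e12, mulVec_inv_mulVec hP]
  rw [symm_dot hPs a (B *ᵥ u), e10, e11]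
  linarith

end Riccati

/-! ### The offline value function. -/

section ValueFunction

variable {n m : ℕ} {A : Matrix (Fin n) (Fin n) ℝ} {B : Matrix (Fin n) (Fin m) ℝ}
  {Q : Matrix (Fin n) (Fin n) ℝ} {R : Matrix (Fin m) (Fin m) ℝ} {P F : Matrix (Fin n) (Fin n) ℝ}

/-- The feedforward vector `v_t = ∑_{i < T - t} (Fᵀ)ⁱ P w_{t+i}` of the offline optimum. -/
def feedforward (F P : Matrix (Fin n) (Fin n) ℝ) (T : ℕ) (w : ℕ → Fin n → ℝ) (t : ℕ) :
    Fin n → ℝ :=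
  ∑ i ∈ range (T - t), (Fᵀ ^ i * P) *ᵥ w (t + i)

lemma feedforward_of_le {T t : ℕ} (w : ℕ → Fin n → ℝ) (h : T ≤ t) :
    feedforward F P T w t = 0 := by
  simp [feedforward, Nat.sub_eq_zero_of_le h]

/-- Separates the `l` terms a policy can use from the tail it must ignore; the `min` stops the sum
at the horizon. -/
lemma feedforward_eq_sum_add (T : ℕ) (w : ℕ → Fin n → ℝ) (t l : ℕ) :
    feedforward F P T w t = ∑ i ∈ range (min l (T - t)), (Fᵀ ^ i * P) *ᵥ w (t + i)
      + (Fᵀ ^ l) *ᵥ feedforward F P T w (t + l) := by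
  rcases le_total (T - t) l with h | h
  · rw [min_eq_right h, feedforward_of_le w (show T ≤ t + l by omega), mulVec_zero, add_zero]
    rfl
  · rw [min_eq_left h, feedforward, feedforward, mulVec_sum,
      show T - t = l + (T - (t + l)) by omega, sum_range_add]
    congr 1
    refine sum_congr rfl fun i _ => ?_
    rw [mulVec_mulVec, ← Matrix.mul_assoc, ← pow_add, add_assoc]

lemma feedforward_succ {T t : ℕ} (w : ℕ → Fin n → ℝ) (h : t < T) :
    feedforward F P T w t = P *ᵥ w t + Fᵀ *ᵥ feedforward F P T w (t + 1) := by
  rw [feedforward_eq_sum_add T w t 1, min_eq_left (by omega)]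
  simp

lemma euNorm_feedforward_le {C G : ℝ} (hC : ∀ T, ∑ i ∈ range T, ‖F ^ i‖ ≤ C) (hG : 0 ≤ G)
    {T : ℕ} {w : ℕ → Fin n → ℝ} (hw : ∀ t < T, euNorm (w t) ≤ G) (t : ℕ) :
    euNorm (feedforward F P T w t) ≤ C * (‖P‖ * G) := by
  refine (euNorm_sum_le _ _).trans ?_
  calc _ ≤ ∑ i ∈ range (T - t), ‖F ^ i‖ * (‖P‖ * G) := by
        refine sum_le_sum fun i hi => ?_
        have := mem_range.1 hi
        rw [← mulVec_mulVec]
        refine (euNorm_mulVec_le _ _).trans ?_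
        rw [← transpose_pow, norm_transpose]
        gcongr
        refine (euNorm_mulVec_le _ _).trans ?_
        gcongr
        exact hw _ (by omega)
    _ = (∑ i ∈ range (T - t), ‖F ^ i‖) * (‖P‖ * G) := by rw [sum_mul]
    _ ≤ _ := by gcongr; exact hC _

/-- The disturbance is controlled by two consecutive feedforward vectors. -/
lemma euNorm_disturbance_le (hP : P.PosDef) {T t : ℕ} (w : ℕ → Fin n → ℝ) (h : t < T) :
    euNorm (w t) ≤ ‖P⁻¹‖ * (euNorm (feedforward F P T w t)
      + ‖F‖ * euNorm (feedforward F P T w (t + 1))) := by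
  have hw : w t = P⁻¹ *ᵥ (feedforward F P T w t - Fᵀ *ᵥ feedforward F P T w (t + 1)) := by
    rw [feedforward_succ w h, add_sub_cancel_right, inv_mulVec_mulVec hP]
  conv_lhs => rw [hw]
  refine (euNorm_mulVec_le _ _).trans ?_
  gcongr
  refine (euNorm_sub_le _ _).trans ?_
  gcongr
  exact (euNorm_mulVec_le _ _).trans_eq (by rw [norm_transpose])

/-- The optimal offline cost for the terminal weight `P`. -/
noncomputable def offlineValue (A : Matrix (Fin n) (Fin n) ℝ) (B : Matrix (Fin n) (Fin m) ℝ)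
    (R : Matrix (Fin m) (Fin m) ℝ) (P : Matrix (Fin n) (Fin n) ℝ) (x₀ : Fin n → ℝ) (T : ℕ)
    (w : ℕ → Fin n → ℝ) : ℝ :=
  let v := feedforward (closedLoop A B R P) P T w
  let y := x₀ + P⁻¹ *ᵥ (closedLoop A B R P)ᵀ *ᵥ v 0
  y ⬝ᵥ P *ᵥ y + ∑ t ∈ range T, v t ⬝ᵥ disturbanceForm A B R P *ᵥ v t

/-- The deviation of the controls `u` from the optimal feedback along their own trajectory. -/
noncomputable def deviation (A : Matrix (Fin n) (Fin n) ℝ) (B : Matrix (Fin n) (Fin m) ℝ)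
    (R : Matrix (Fin m) (Fin m) ℝ) (P : Matrix (Fin n) (Fin n) ℝ) (x₀ : Fin n → ℝ) (T : ℕ)
    (w : ℕ → Fin n → ℝ) (u : ℕ → Fin m → ℝ) (t : ℕ) : Fin m → ℝ :=
  u t + ((R + Bᵀ * P * B)⁻¹ * Bᵀ) *ᵥ (P *ᵥ A *ᵥ traj A B x₀ w u t
    + feedforward (closedLoop A B R P) P T w t)

/-- The cost with terminal weight `P` exceeds the optimum by the cost of the deviations. -/
lemma cost_eq_offlineValue_add (hR : R.PosDef) (hP : P.PosDef)
    (hric : P = Q + Aᵀ * P * A - Aᵀ * P * B * (R + Bᵀ * P * B)⁻¹ * Bᵀ * P * A)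
    (x₀ : Fin n → ℝ) (T : ℕ) (w : ℕ → Fin n → ℝ) (u : ℕ → Fin m → ℝ) :
    cost A B Q R P x₀ T w u = offlineValue A B R P x₀ T w
      + ∑ t ∈ range T, deviation A B R P x₀ T w u t
          ⬝ᵥ (R + Bᵀ * P * B) *ᵥ deviation A B R P x₀ T w u t := by
  set F := closedLoop A B R P with hF
  set v := feedforward F P T w with hv
  set x := traj A B x₀ w u with hx
  -- The shift absorbs the linear term of the cost-to-go. By the recursion for `v`, `y (t + 1) = A
  -- x_t + B u_t + P⁻¹ v_t`, so `step_identity` telescopes.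
  set y : ℕ → Fin n → ℝ := fun t => x t + P⁻¹ *ᵥ Fᵀ *ᵥ v t with hy
  have hstep : ∀ t ∈ range T, x t ⬝ᵥ Q *ᵥ x t + u t ⬝ᵥ R *ᵥ u t
      = (y t ⬝ᵥ P *ᵥ y t - y (t + 1) ⬝ᵥ P *ᵥ y (t + 1)) + (v t ⬝ᵥ disturbanceForm A B R P *ᵥ v t
        + deviation A B R P x₀ T w u t
          ⬝ᵥ (R + Bᵀ * P * B) *ᵥ deviation A B R P x₀ T w u t) := by
    intro t ht
    have h := step_identity hR hP hric (x t) (v t) (u t) (deviation A B R P x₀ T w u t) rfl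
    have hy1 : y (t + 1) = A *ᵥ x t + B *ᵥ u t + P⁻¹ *ᵥ v t := by
      rw [hv, feedforward_succ w (mem_range.1 ht), mulVec_add, inv_mulVec_mulVec hP, ← add_assoc]
      rfl
    rw [hy1]
    linarith
  have hyT : y T = x T := by
    simp only [hy, hv, feedforward_of_le w le_rfl, mulVec_zero, add_zero]
  rw [cost, ← hx, sum_congr rfl hstep, sum_add_distrib, sum_range_sub', sum_add_distrib, hyT]
  have h0 : offlineValue A B R P x₀ T w
    = y 0 ⬝ᵥ P *ᵥ y 0 + ∑ t ∈ range T, v t ⬝ᵥ disturbanceForm A B R P *ᵥ v t := rfl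
  rw [h0]
  ring

/-- The lower bound on the optimum that puts `λ` in the denominator of the ratio. -/
lemma mul_sum_le_offlineValue (hR : R.PosDef) (hP : P.PosDef) (x₀ : Fin n → ℝ) (T : ℕ)
    (w : ℕ → Fin n → ℝ) :
    lambdaMin (disturbanceForm A B R P)
        * ∑ t ∈ range T, euNorm (feedforward (closedLoop A B R P) P T w t) ^ 2
      ≤ offlineValue A B R P x₀ T w := by
  rw [mul_sum]
  exact (sum_le_sum fun t _ => lambdaMin_mul_le (isHermitian_disturbanceForm hR hP) _).trans
    (le_add_of_nonneg_left (hP.posSemidef.dot_nonneg _))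

end ValueFunction

/-! ### The cost of leaving the optimal trajectory, for a general terminal weight. -/

section ArrivalCost

variable {n m : ℕ} {A : Matrix (Fin n) (Fin n) ℝ} {B : Matrix (Fin n) (Fin m) ℝ}
  {Q : Matrix (Fin n) (Fin n) ℝ} {R : Matrix (Fin m) (Fin m) ℝ} {P : Matrix (Fin n) (Fin n) ℝ}

lemma closedLoop_lyapunov (hR : R.PosDef) (hP : P.PosDef) (x : Fin n → ℝ) :
    (closedLoop A B R P)ᵀ *ᵥ x ⬝ᵥ P⁻¹ *ᵥ (closedLoop A B R P)ᵀ *ᵥ x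
      + lambdaMin (disturbanceForm A B R P) * euNorm x ^ 2 + x ⬝ᵥ gainH B R P *ᵥ x
      ≤ x ⬝ᵥ P⁻¹ *ᵥ x := by
  have h := lambdaMin_mul_le (isHermitian_disturbanceForm (A := A) (B := B) hR hP) x
  rw [disturbanceForm_apply] at h
  linarith

/-- Fenchel–Young inequality: expand the `S`-square of `δ - S⁻¹ Bᵀ p`. -/
lemma two_mul_dot_sub_le_inputCost (hR : R.PosDef) (hP : P.PosDef) (p : Fin n → ℝ)
    (δ : Fin m → ℝ) :
    2 * (p ⬝ᵥ B *ᵥ δ) - p ⬝ᵥ gainH B R P *ᵥ p ≤ δ ⬝ᵥ (R + Bᵀ * P * B) *ᵥ δ := by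
  have hS := posDef_inputCost (B := B) hR hP
  have h := hS.posSemidef.dot_nonneg (δ - ((R + Bᵀ * P * B)⁻¹ * Bᵀ) *ᵥ p)
  have h1 := inputCost_gain (B := B) hR hP p
  have h2 : δ ⬝ᵥ (R + Bᵀ * P * B) *ᵥ ((R + Bᵀ * P * B)⁻¹ * Bᵀ) *ᵥ p = p ⬝ᵥ B *ᵥ δ := by
    rw [← mulVec_mulVec p, mulVec_inv_mulVec hS, ← mulVec_dotProduct, dotProduct_comm]
  simp only [mulVec_sub, dotProduct_sub, sub_dotProduct] at h
  rw [symm_dot hS.posSemidef (((R + Bᵀ * P * B)⁻¹ * Bᵀ) *ᵥ p) δ, h2, h1] at h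
  linarith

/-- Driving the closed loop from `0` to `z_T` costs strictly more than `z_Tᵀ P z_T`. -/
lemma arrival_cost (hR : R.PosDef) (hP : P.PosDef)
    (hlam : 0 < lambdaMin (disturbanceForm A B R P)) {z : ℕ → Fin n → ℝ} {δ : ℕ → Fin m → ℝ}
    (h0 : z 0 = 0) (hz : ∀ t, z (t + 1) = closedLoop A B R P *ᵥ z t + B *ᵥ δ t) (T : ℕ) :
    z T ⬝ᵥ P *ᵥ z T + lambdaMin (disturbanceForm A B R P) * euNorm (P *ᵥ z T) ^ 2
      ≤ ∑ t ∈ range T, δ t ⬝ᵥ (R + Bᵀ * P * B) *ᵥ δ t := by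
  set l := lambdaMin (disturbanceForm A B R P) with hl
  -- Dual form of the claim. A free `p` lets the induction pass from `p` to `Fᵀ p`; the choice `p =
  -- P z_T` then gives the primal bound.
  have key : ∀ T p, 2 * (p ⬝ᵥ z T) - (p ⬝ᵥ P⁻¹ *ᵥ p - l * euNorm p ^ 2)
      ≤ ∑ t ∈ range T, δ t ⬝ᵥ (R + Bᵀ * P * B) *ᵥ δ t := by
    intro T
    induction T with
    | zero =>
      intro p
      have h1 := closedLoop_lyapunov (A := A) (B := B) hR hP p
      have h2 := hP.inv.posSemidef.dot_nonneg ((closedLoop A B R P)ᵀ *ᵥ p)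
      have h3 := (posSemidef_gainH (B := B) hR hP).dot_nonneg p
      simp only [h0, dotProduct_zero, range_zero, sum_empty]
      linarith
    | succ T ih =>
      intro p
      have h1 := closedLoop_lyapunov (A := A) (B := B) hR hP p
      have h2 := ih ((closedLoop A B R P)ᵀ *ᵥ p)
      have h3 := two_mul_dot_sub_le_inputCost (B := B) hR hP p (δ T)
      have h4 := mul_nonneg hlam.le (sq_nonneg (euNorm ((closedLoop A B R P)ᵀ *ᵥ p)))
      rw [mulVec_dotProduct _ p (z T), transpose_transpose] at h2
      rw [sum_range_succ, hz, dotProduct_add]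
      linarith
  have h := key T (P *ᵥ z T)
  rw [inv_mulVec_mulVec hP, dotProduct_comm (P *ᵥ z T)] at h
  linarith

/-- The optimal trajectory for the terminal weight `P`. -/
noncomputable def offlineTraj (A : Matrix (Fin n) (Fin n) ℝ) (B : Matrix (Fin n) (Fin m) ℝ)
    (R : Matrix (Fin m) (Fin m) ℝ) (P : Matrix (Fin n) (Fin n) ℝ) (x₀ : Fin n → ℝ) (T : ℕ)
    (w : ℕ → Fin n → ℝ) : ℕ → Fin n → ℝ
  | 0 => x₀
  | t + 1 => closedLoop A B R P *ᵥ offlineTraj A B R P x₀ T w t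
      + (w t - gainH B R P *ᵥ feedforward (closedLoop A B R P) P T w t)

lemma traj_succ_closedLoop (x₀ : Fin n → ℝ) (T : ℕ) (w : ℕ → Fin n → ℝ) (u : ℕ → Fin m → ℝ)
    (t : ℕ) :
    traj A B x₀ w u (t + 1) = closedLoop A B R P *ᵥ traj A B x₀ w u t
      + (w t - gainH B R P *ᵥ feedforward (closedLoop A B R P) P T w t)
      + B *ᵥ deviation A B R P x₀ T w u t :=
  closedLoop_eq_add _ _ _ _

/-- A terminal weight other than `P` lowers the optimum by a bounded amount only. -/
lemma offlineValue_le_cost_add (hR : R.PosDef) (hP : P.PosDef)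
    (hric : P = Q + Aᵀ * P * A - Aᵀ * P * B * (R + Bᵀ * P * B)⁻¹ * Bᵀ * P * A)
    (hlam : 0 < lambdaMin (disturbanceForm A B R P)) {Qf : Matrix (Fin n) (Fin n) ℝ}
    (hQf : Qf.PosSemidef) (x₀ : Fin n → ℝ) (T : ℕ) (w : ℕ → Fin n → ℝ) (u : ℕ → Fin m → ℝ)
    {Y : ℝ} (hY : euNorm (offlineTraj A B R P x₀ T w T) ≤ Y) :
    offlineValue A B R P x₀ T w ≤ cost A B Q R Qf x₀ T w u
      + (‖P‖ * Y ^ 2 + Y ^ 2 / lambdaMin (disturbanceForm A B R P)) := by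
  set l := lambdaMin (disturbanceForm A B R P) with hl
  set x := traj A B x₀ w u with hx
  set y := offlineTraj A B R P x₀ T w with hy
  set z : ℕ → Fin n → ℝ := fun t => x t - y t with hz
  have harr := arrival_cost (z := z) (δ := deviation A B R P x₀ T w u) hR hP hlam
    (by simp only [hz, hx, hy, traj, offlineTraj, sub_self]) (fun t => by
      simp only [hz, hx, traj_succ_closedLoop (R := R) (P := P) x₀ T w u t, hy, offlineTraj,
        mulVec_sub]
      abel) T
  have hcost := cost_eq_offlineValue_add hR hP hric x₀ T w u
  have hQfP : cost A B Q R P x₀ T w u ≤ cost A B Q R Qf x₀ T w u + x T ⬝ᵥ P *ᵥ x T := by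
    have := hQf.dot_nonneg (x T)
    simp only [cost, ← hx]
    linarith
  have hxyz : x T = y T + z T := by simp [hz]
  have hsplit : x T ⬝ᵥ P *ᵥ x T
      = y T ⬝ᵥ P *ᵥ y T + 2 * (y T ⬝ᵥ P *ᵥ z T) + z T ⬝ᵥ P *ᵥ z T := by
    rw [hxyz]
    simp only [mulVec_add, dotProduct_add, add_dotProduct]
    rw [symm_dot hP.posSemidef (z T) (y T)]
    ring
  have hY0 : 0 ≤ euNorm (y T) := euNorm_nonneg _
  have hy1 : y T ⬝ᵥ P *ᵥ y T ≤ ‖P‖ * Y ^ 2 :=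
    (dotProduct_mulVec_le _ _).trans (by gcongr)
  have hy2 : y T ⬝ᵥ P *ᵥ z T ≤ Y * euNorm (P *ᵥ z T) :=
    (dotProduct_le_euNorm _ _).trans (by gcongr; exact euNorm_nonneg _)
  -- The surplus `l ‖P z_T‖²` of the arrival cost absorbs the cross term, however large `z T` is.
  have hsq : 2 * (Y * euNorm (P *ᵥ z T)) ≤ Y ^ 2 / l + l * euNorm (P *ᵥ z T) ^ 2 := by
    have h := sq_nonneg (Y - l * euNorm (P *ᵥ z T))
    rw [← sub_nonneg, show Y ^ 2 / l + l * euNorm (P *ᵥ z T) ^ 2 - 2 * (Y * euNorm (P *ᵥ z T))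
      = (Y - l * euNorm (P *ᵥ z T)) ^ 2 / l by field_simp; ring]
    positivity
  linarith

end ArrivalCost

/-! ### From control errors to the competitive ratio. -/

section RegretBound

variable {n m : ℕ} {A : Matrix (Fin n) (Fin n) ℝ} {B : Matrix (Fin n) (Fin m) ℝ}
  {Q : Matrix (Fin n) (Fin n) ℝ} {R : Matrix (Fin m) (Fin m) ℝ} {P F : Matrix (Fin n) (Fin n) ℝ}

/-- The norm of `w_s`, set to zero beyond the horizon `T`. -/
noncomputable def truncNorm (T : ℕ) (w : ℕ → Fin n → ℝ) (s : ℕ) : ℝ :=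
  if s < T then euNorm (w s) else 0

lemma truncNorm_nonneg (T : ℕ) (w : ℕ → Fin n → ℝ) (s : ℕ) : 0 ≤ truncNorm T w s := by
  unfold truncNorm
  split_ifs
  exacts [euNorm_nonneg _, le_rfl]

/-- The bound on the error of a control at time `t` in terms of the weights `a i` of the
disturbances `w_{t+i-d}` and the weight `b` of the feedforward vector `v_{t+l}`. -/
noncomputable def errorBound (F P : Matrix (Fin n) (Fin n) ℝ) (d K l : ℕ) (a : ℕ → ℝ) (b : ℝ)
    (T : ℕ) (w : ℕ → Fin n → ℝ) (t : ℕ) : ℝ :=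
  ∑ i ∈ range K, ‖P‖ * a i * (if d ≤ t + i then truncNorm T w (t + i - d) else 0)
    + b * euNorm (feedforward F P T w (t + l))

/-- Origin of `c`: `‖P‖` comes from the feedback, `‖P⁻¹‖ (1 + ‖F‖)` from recovering `w` out of two
consecutive `v`. -/
lemma sum_errorBound_sq_le (hP : P.PosDef) (d K l : ℕ) {a : ℕ → ℝ} {b : ℝ} (ha : ∀ i, 0 ≤ a i)
    (hb : 0 ≤ b) (T : ℕ) (w : ℕ → Fin n → ℝ) :
    ∑ t ∈ range T, errorBound F P d K l a b T w t ^ 2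
      ≤ (‖P‖ * ‖P⁻¹‖ * (1 + ‖F‖) * ∑ i ∈ range K, a i + b) ^ 2
        * ∑ t ∈ range T, euNorm (feedforward F P T w t) ^ 2 := by
  set v := feedforward F P T w with hv
  set V := ∑ t ∈ range T, euNorm (v t) ^ 2 with hVdef
  have hV : 0 ≤ V := sum_nonneg fun _ _ => sq_nonneg _
  have hvT : ∀ s, T ≤ s → euNorm (v s) ^ 2 = 0 := fun s hs => by
    rw [hv, feedforward_of_le w hs]; simp
  have hshift : ∀ j, ∑ t ∈ range T, euNorm (v (t + j)) ^ 2 ≤ V := fun j => by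
    simpa using sum_shift_le (T := T) (fun s => sq_nonneg (euNorm (v s))) hvT 0 j
  have hω : ∑ s ∈ range T, truncNorm T w s ^ 2 ≤ (‖P⁻¹‖ * (1 + ‖F‖)) ^ 2 * V := by
    calc _ ≤ ∑ s ∈ range T, (‖P⁻¹‖ * (euNorm (v s) + ‖F‖ * euNorm (v (s + 1)))) ^ 2 := by
          refine sum_le_sum fun s hs => ?_
          refine pow_le_pow_left₀ (truncNorm_nonneg _ _ _) ?_ 2
          rw [truncNorm, if_pos (mem_range.1 hs)]
          exact euNorm_disturbance_le hP w (mem_range.1 hs)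
      _ ≤ _ := by
          refine sum_sq_mul_le _ (sum_sq_add_le hV zero_le_one (norm_nonneg F) ?_ ?_)
          · simp [hVdef]
          · simpa using sum_sq_mul_le (α := 1) ‖F‖ (by simpa using hshift 1)
  have hterm : ∀ i, ∑ t ∈ range T,
      (‖P‖ * a i * (if d ≤ t + i then truncNorm T w (t + i - d) else 0)) ^ 2
        ≤ (‖P‖ * a i * (‖P⁻¹‖ * (1 + ‖F‖))) ^ 2 * V := by
    intro i
    refine sum_sq_mul_le _ (le_trans ?_ hω)
    have h := sum_shift_le (T := T) (g := fun s => truncNorm T w s ^ 2) (fun s => sq_nonneg _)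
      (fun s hs => by simp [truncNorm, not_lt.2 hs]) d i
    refine le_trans (sum_le_sum fun t _ => le_of_eq ?_) h
    split_ifs <;> simp
  have hsum := sum_sq_sum_le hV (fun i => by have := ha i; positivity) K hterm
  have hlast : ∑ t ∈ range T, (b * euNorm (v (t + l))) ^ 2 ≤ (b * 1) ^ 2 * V :=
    sum_sq_mul_le b (by simpa using hshift l)
  have h := sum_sq_add_le hV (sum_nonneg fun i _ => by have := ha i; positivity)
    (by positivity) hsum hlast
  refine h.trans_eq ?_
  rw [mul_one, show ∑ i ∈ range K, ‖P‖ * a i * (‖P⁻¹‖ * (1 + ‖F‖))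
    = ‖P‖ * ‖P⁻¹‖ * (1 + ‖F‖) * ∑ i ∈ range K, a i by
      rw [mul_sum]; exact sum_congr rfl fun i _ => by ring]

lemma errorBound_le {d K l : ℕ} {a : ℕ → ℝ} {b G Vb : ℝ} (ha : ∀ i, 0 ≤ a i)
    (hb : 0 ≤ b) (hG : 0 ≤ G) {T : ℕ} {w : ℕ → Fin n → ℝ} (hw : ∀ t < T, euNorm (w t) ≤ G)
    (hv : ∀ t, euNorm (feedforward F P T w t) ≤ Vb) (t : ℕ) :
    errorBound F P d K l a b T w t ≤ ∑ i ∈ range K, ‖P‖ * a i * G + b * Vb := by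
  refine add_le_add (sum_le_sum fun i _ => ?_) (mul_le_mul_of_nonneg_left (hv _) hb)
  have := ha i
  refine mul_le_mul_of_nonneg_left ?_ (by positivity)
  unfold truncNorm
  split_ifs with h1 h2
  exacts [hw _ h2, hG, hG]

/-- Competitive bound for controls whose deviation from the optimal feedback is `S⁻¹ Bᵀ φ_t`
with `φ_t` bounded by `errorBound`. -/
theorem exists_cost_le (hR : R.PosDef) (hP : P.PosDef)
    (hric : P = Q + Aᵀ * P * A - Aᵀ * P * B * (R + Bᵀ * P * B)⁻¹ * Bᵀ * P * A)
    (hlam : 0 < lambdaMin (disturbanceForm A B R P)) {Qf : Matrix (Fin n) (Fin n) ℝ}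
    (hQf : Qf.PosSemidef) (x₀ : Fin n → ℝ) (r : ℝ) (d K l : ℕ) {a : ℕ → ℝ} {b : ℝ}
    (ha : ∀ i, 0 ≤ a i) (hb : 0 ≤ b) :
    ∃ κ : ℝ, (Qf = P → κ = 0) ∧ ∀ (T : ℕ) (w : ℕ → Fin n → ℝ) (u : ℕ → Fin m → ℝ),
      (∀ t < T, euNorm (w t) ≤ r) →
      (∀ t < T, ∃ φ : Fin n → ℝ,
        deviation A B R P x₀ T w u t = ((R + Bᵀ * P * B)⁻¹ * Bᵀ) *ᵥ φ ∧
        euNorm φ ≤ errorBound (closedLoop A B R P) P d K l a b T w t) →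
      cost A B Q R Qf x₀ T w u ≤
        ((‖P‖ * ‖P⁻¹‖ * (1 + ‖closedLoop A B R P‖) * ∑ i ∈ range K, a i + b) ^ 2 * ‖gainH B R P‖
          / lambdaMin (disturbanceForm A B R P) + 1) * optCost A B Q R Qf x₀ T w + κ := by
  set F := closedLoop A B R P with hF
  set H := gainH B R P with hH
  set lam := lambdaMin (disturbanceForm A B R P) with hlamdef
  set β := ‖P‖ * ‖P⁻¹‖ * (1 + ‖F‖) * ∑ i ∈ range K, a i + b with hβ
  set ratio := β ^ 2 * ‖H‖ / lam + 1 with hratio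
  have hratio0 : 0 ≤ ratio := by positivity
  have hmain : ∀ (T : ℕ) (w : ℕ → Fin n → ℝ) (u : ℕ → Fin m → ℝ),
      (∀ t < T, ∃ φ : Fin n → ℝ,
        deviation A B R P x₀ T w u t = ((R + Bᵀ * P * B)⁻¹ * Bᵀ) *ᵥ φ ∧
        euNorm φ ≤ errorBound F P d K l a b T w t) →
      cost A B Q R P x₀ T w u ≤ ratio * offlineValue A B R P x₀ T w := by
    intro T w u hu
    have h1 : ∑ t ∈ range T, deviation A B R P x₀ T w u t
        ⬝ᵥ (R + Bᵀ * P * B) *ᵥ deviation A B R P x₀ T w u t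
        ≤ ‖H‖ * (β ^ 2 * ∑ t ∈ range T, euNorm (feedforward F P T w t) ^ 2) := by
      refine le_trans ?_ (mul_le_mul_of_nonneg_left
        (sum_errorBound_sq_le hP d K l ha hb T w) (norm_nonneg H))
      rw [mul_sum]
      refine sum_le_sum fun t ht => ?_
      obtain ⟨φ, hφ, hle⟩ := hu t (mem_range.1 ht)
      rw [hφ, inputCost_gain hR hP]
      refine (dotProduct_mulVec_le _ _).trans ?_
      gcongr
      exact euNorm_nonneg _
    have h2 := mul_sum_le_offlineValue (A := A) (B := B) hR hP x₀ T w
    rw [← le_div_iff₀' hlam] at h2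
    rw [cost_eq_offlineValue_add hR hP hric, hratio, add_mul, one_mul, add_comm]
    gcongr
    refine h1.trans ((mul_le_mul_of_nonneg_left (mul_le_mul_of_nonneg_left h2 (sq_nonneg β))
      (norm_nonneg H)).trans_eq (by ring))
  by_cases hQfP : Qf = P
  · subst hQfP
    refine ⟨0, fun _ => rfl, fun T w u _ hu => ?_⟩
    rw [add_zero]
    refine (hmain T w u hu).trans (mul_le_mul_of_nonneg_left (le_ciInf fun u' => ?_) hratio0)
    rw [cost_eq_offlineValue_add hR hP hric]
    exact le_add_of_nonneg_right (sum_nonneg fun t _ =>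
      (posDef_inputCost hR hP).posSemidef.dot_nonneg _)
  obtain ⟨C, hC0, hC⟩ := exists_sum_norm_pow_le hlam hP.inv.posSemidef (F := F) fun x => by
    linarith [closedLoop_lyapunov (A := A) (B := B) hR hP x,
      (posSemidef_gainH (B := B) hR hP).dot_nonneg x]
  -- A negative `r` is allowed; it forces `T = 0`.
  set G := max r 0 with hG
  have hG0 : 0 ≤ G := le_max_right _ _
  set Vb := C * (‖P‖ * G) with hVb
  have hVb0 : 0 ≤ Vb := by positivity
  set Φ := ∑ i ∈ range K, ‖P‖ * a i * G + b * Vb with hΦ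
  have hΦ0 : 0 ≤ Φ :=
    add_nonneg (sum_nonneg fun i _ => by have := ha i; positivity) (by positivity)
  -- `Y` bounds the terminal state of the `P`-optimal trajectory, `X` that of the policy, whose
  -- input carries the extra error `H φ`.
  set Y := C * (euNorm x₀ + (G + ‖H‖ * Vb)) with hY
  set X := C * (euNorm x₀ + (G + ‖H‖ * Vb + ‖H‖ * Φ)) with hX
  -- The first term exchanges the terminal weight in the policy's cost, the second in the optimum,
  -- scaled by the ratio.
  refine ⟨‖Qf - P‖ * X ^ 2 + ratio * (‖P‖ * Y ^ 2 + Y ^ 2 / lam), fun h => absurd h hQfP,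
    fun T w u hw hu => ?_⟩
  have hw' : ∀ t < T, euNorm (w t) ≤ G := fun t ht => (hw t ht).trans (le_max_left _ _)
  have hv := euNorm_feedforward_le (P := P) hC hG0 hw'
  have hin : ∀ t < T, euNorm (w t - H *ᵥ feedforward F P T w t) ≤ G + ‖H‖ * Vb := by
    intro t ht
    refine (euNorm_sub_le _ _).trans (add_le_add (hw' t ht) ((euNorm_mulVec_le _ _).trans ?_))
    gcongr
    exact hv t
  have hYb : euNorm (offlineTraj A B R P x₀ T w T) ≤ Y :=
    euNorm_recursion_le hC (by positivity) (fun t _ => rfl) hin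
  have hXb : euNorm (traj A B x₀ w u T) ≤ X := by
    refine euNorm_recursion_le hC (by positivity)
      (fun t _ => (traj_succ_closedLoop (R := R) (P := P) x₀ T w u t).trans (add_assoc _ _ _))
      fun t ht => ?_
    obtain ⟨φ, hφ, hle⟩ := hu t ht
    refine (euNorm_add_le _ _).trans (add_le_add (hin t ht) ?_)
    rw [hφ, mulVec_mulVec, ← Matrix.mul_assoc]
    refine (euNorm_mulVec_le _ _).trans ?_
    exact mul_le_mul_of_nonneg_left (hle.trans (errorBound_le ha hb hG0 hw' hv t)) (norm_nonneg _)
  have hopt : offlineValue A B R P x₀ T w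
      ≤ optCost A B Q R Qf x₀ T w + (‖P‖ * Y ^ 2 + Y ^ 2 / lam) := by
    rw [← sub_le_iff_le_add]
    refine le_ciInf fun u' => ?_
    rw [sub_le_iff_le_add]
    exact offlineValue_le_cost_add hR hP hric hlam hQf x₀ T w u' hYb
  have hterm : cost A B Q R Qf x₀ T w u ≤ cost A B Q R P x₀ T w u + ‖Qf - P‖ * X ^ 2 := by
    have h := dotProduct_mulVec_le (Qf - P) (traj A B x₀ w u T)
    rw [sub_mulVec, dotProduct_sub] at h
    have h' : ‖Qf - P‖ * euNorm (traj A B x₀ w u T) ^ 2 ≤ ‖Qf - P‖ * X ^ 2 := by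
      gcongr
      exact euNorm_nonneg _
    simp only [cost]
    linarith
  have := mul_le_mul_of_nonneg_left hopt hratio0
  linarith [hmain T w u hu]

end RegretBound

/-! ### Errors of the myopic policy. -/

section Policy

variable {n m : ℕ} {A : Matrix (Fin n) (Fin n) ℝ} {B : Matrix (Fin n) (Fin m) ℝ}
  {R : Matrix (Fin m) (Fin m) ℝ} {P F : Matrix (Fin n) (Fin n) ℝ}

lemma traj_congr (x₀ : Fin n → ℝ) (w : ℕ → Fin n → ℝ) {u u' : ℕ → Fin m → ℝ} {t : ℕ}
    (h : ∀ s < t, u s = u' s) : ∀ s ≤ t, traj A B x₀ w u s = traj A B x₀ w u' s := by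
  intro s hs
  induction s with
  | zero => rfl
  | succ s ih => rw [traj, traj, ih (by omega), h s (by omega)]

lemma stateEstimate_congr (d t : ℕ) {x x' : ℕ → Fin n → ℝ} {u u' : ℕ → Fin m → ℝ}
    {v v' : ℕ → Fin n → ℝ} {p : ℕ} (hx : ∀ s ≤ p, x s = x' s) (hu : ∀ s < p, u s = u' s)
    (hv : ∀ s < p, v s = v' s) :
    ∀ s ≤ p, stateEstimate A B d t x u v s = stateEstimate A B d t x' u' v' s := by
  intro s hs
  induction s with
  | zero => exact hx 0 hs
  | succ s ih =>
    rw [stateEstimate, stateEstimate, ih (by omega), hx _ hs, hu s (by omega), hv s (by omega)]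

lemma myopicAction_congr (d k T t : ℕ) {x x' : ℕ → Fin n → ℝ} {u u' : ℕ → Fin m → ℝ}
    (v : ℕ → Fin n → ℝ) (hx : ∀ s ≤ t, x s = x' s) (hu : ∀ s < t, u s = u' s) :
    myopicAction A B R P d k T t x u v = myopicAction A B R P d k T t x' u' v := by
  have hest := stateEstimate_congr (A := A) (B := B) d t (v := v) hx hu fun _ _ => rfl
  rw [myopicAction, myopicAction, hest t le_rfl, hest _ (Nat.sub_le t (min (d - k) t))]
  have hsum : ∑ i ∈ range (min (d - k) t), (A ^ i * B) *ᵥ u (t - 1 - i)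
      = ∑ i ∈ range (min (d - k) t), (A ^ i * B) *ᵥ u' (t - 1 - i) := by
    refine sum_congr rfl fun i hi => ?_
    have := mem_range.1 hi
    rw [hu _ (by omega)]
  rw [hsum]

/-- Causality: the action reads only earlier controls, so the truncated past may be replaced by the
full closed-loop sequence. -/
lemma myopicControl_eq (d k T : ℕ) (x₀ : Fin n → ℝ) (w : ℕ → Fin n → ℝ)
    (what : ℕ → ℕ → Fin n → ℝ) (t : ℕ) :
    myopicControl A B R P d k T x₀ w what t
      = myopicAction A B R P d k T t (traj A B x₀ w (myopicControl A B R P d k T x₀ w what))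
          (myopicControl A B R P d k T x₀ w what) (fun s => what s t) := by
  rw [myopicControl]
  have h : ∀ s < t, (if _h : s < t then myopicControl A B R P d k T x₀ w what s else 0)
      = myopicControl A B R P d k T x₀ w what s := fun s hs => dif_pos hs
  exact myopicAction_congr d k T t _ (traj_congr x₀ w h) h

/-- Controls enter the state and its estimate alike and cancel. Truncated subtraction makes `t - d`
the last observed time. -/
lemma traj_sub_stateEstimate (d t : ℕ) (x₀ : Fin n → ℝ) (w v : ℕ → Fin n → ℝ)
    (u : ℕ → Fin m → ℝ) (s : ℕ) :
    traj A B x₀ w u s - stateEstimate A B d t (traj A B x₀ w u) u v s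
      = ∑ j ∈ Ico (t - d) s, (A ^ (s - 1 - j)) *ᵥ (w j - v j) := by
  induction s with
  | zero => simp [stateEstimate]
  | succ s ih =>
    rw [stateEstimate]
    split_ifs with h
    · rw [sub_self, Ico_eq_empty (by omega), sum_empty]
    · rw [sum_Ico_succ_top (by omega)]
      have h1 : ∑ j ∈ Ico (t - d) s, (A ^ (s + 1 - 1 - j)) *ᵥ (w j - v j)
          = A *ᵥ ∑ j ∈ Ico (t - d) s, (A ^ (s - 1 - j)) *ᵥ (w j - v j) := by
        rw [mulVec_sum]
        refine sum_congr rfl fun j hj => ?_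
        have := mem_Ico.1 hj
        rw [mulVec_mulVec, ← pow_succ']
        congr 2
        omega
      rw [h1, ← ih, traj, mulVec_sub]
      simp only [add_tsub_cancel_right, tsub_self, pow_zero, one_mulVec]
      abel

/-- Open-loop propagation of an estimate is the estimate with predictions set to zero. -/
lemma stateEstimate_add (d t : ℕ) {x : ℕ → Fin n → ℝ} {u : ℕ → Fin m → ℝ}
    {v v' : ℕ → Fin n → ℝ} {p j : ℕ} (hp : t - d ≤ p) (hv : ∀ s < p, v' s = v s)
    (hv0 : ∀ s, p ≤ s → v' s = 0) :
    stateEstimate A B d t x u v' (p + j) = (A ^ j) *ᵥ stateEstimate A B d t x u v p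
      + ∑ i ∈ range j, (A ^ i * B) *ᵥ u (p + j - 1 - i) := by
  induction j with
  | zero =>
    simpa using stateEstimate_congr (A := A) (B := B) d t (x := x) (u := u) (fun _ _ => rfl)
      (fun _ _ => rfl) hv p le_rfl
  | succ j ih =>
    rw [← add_assoc, stateEstimate, if_neg (by omega), ih, hv0 _ (by omega), sum_range_succ',
      mulVec_add, mulVec_sum, mulVec_mulVec, ← pow_succ', add_zero, add_assoc]
    congr 2
    · refine sum_congr rfl fun i _ => ?_
      rw [mulVec_mulVec, ← Matrix.mul_assoc, ← pow_succ']
      congr 2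
      omega
    · simp

/-- Reindexing by `s = t + i - d` turns `A ^ (t - s)` into `A ^ (d - i)`. A general weight `e` also
covers disturbances that are not predicted, with `e i = 1`. -/
lemma euNorm_propagated_error_le (d : ℕ) {T t : ℕ} (ht : t < T) {w g : ℕ → Fin n → ℝ}
    {e : ℕ → ℝ} (hg : ∀ s, t - d ≤ s → s < t → euNorm (g s) ≤ e (s + d - t) * euNorm (w s)) :
    euNorm (P *ᵥ A *ᵥ ∑ j ∈ Ico (t - d) t, (A ^ (t - 1 - j)) *ᵥ g j)
      ≤ ∑ i ∈ range d, ‖P‖ * (e i * ‖A ^ (d - i)‖)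
          * (if d ≤ t + i then truncNorm T w (t + i - d) else 0) := by
  simp only [mul_ite, mul_zero]
  rw [← sum_filter, mulVec_sum, mulVec_sum]
  refine (euNorm_sum_le _ _).trans ?_
  have hterm : ∀ s ∈ Ico (t - d) t, euNorm (P *ᵥ A *ᵥ (A ^ (t - 1 - s)) *ᵥ g s)
      ≤ ‖P‖ * (e (s + d - t) * ‖A ^ (t - s)‖) * euNorm (w s) := by
    intro s hs
    obtain ⟨h1, h2⟩ := mem_Ico.1 hs
    rw [mulVec_mulVec _ A, ← pow_succ', show t - 1 - s + 1 = t - s by omega]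
    calc _ ≤ ‖P‖ * (‖A ^ (t - s)‖ * (e (s + d - t) * euNorm (w s))) := by
          refine (euNorm_mulVec_le _ _).trans ?_
          gcongr
          refine (euNorm_mulVec_le _ _).trans ?_
          gcongr
          exact hg s h1 h2
      _ = _ := by ring
  refine (sum_le_sum hterm).trans_eq ?_
  refine sum_nbij' (fun s => s + d - t) (fun i => t + i - d) ?_ ?_ ?_ ?_ ?_
  · intro s hs
    rw [mem_Ico] at hs
    rw [mem_filter, mem_range]
    omega
  · intro i hi
    rw [mem_filter, mem_range] at hi
    rw [mem_Ico]
    omega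
  · intro s hs
    rw [mem_Ico] at hs
    omega
  · intro i hi
    rw [mem_filter, mem_range] at hi
    omega
  · intro s hs
    rw [mem_Ico] at hs
    rw [show t + (s + d - t) - d = s by omega, show d - (s + d - t) = t - s by omega,
      truncNorm, if_pos (by omega)]

lemma deviation_eq_of_control_eq {x₀ : Fin n → ℝ} {T t : ℕ} {w : ℕ → Fin n → ℝ}
    {u : ℕ → Fin m → ℝ} {y : Fin n → ℝ}
    (hu : u t = -(((R + Bᵀ * P * B)⁻¹ * Bᵀ) *ᵥ y)) :
    deviation A B R P x₀ T w u t = ((R + Bᵀ * P * B)⁻¹ * Bᵀ) *ᵥ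
      (P *ᵥ A *ᵥ traj A B x₀ w u t + feedforward (closedLoop A B R P) P T w t - y) := by
  rw [deviation, hu, mulVec_sub]
  abel

/-- Error of the policy when the number of predictions is at least the delay. -/
lemma exists_error_of_delay_le {d k T t : ℕ} (hdk : d ≤ k) (ht : t < T) (x₀ : Fin n → ℝ)
    {ε : ℕ → ℝ} (hε : ∀ i, 0 ≤ ε i) {w : ℕ → Fin n → ℝ} {what : ℕ → ℕ → Fin n → ℝ}
    (hpred : PredictionErrorBound d T ε w what) :
    ∃ φ : Fin n → ℝ,
      deviation A B R P x₀ T w (myopicControl A B R P d k T x₀ w what) t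
        = ((R + Bᵀ * P * B)⁻¹ * Bᵀ) *ᵥ φ ∧
      euNorm φ ≤ errorBound (closedLoop A B R P) P d k (k - d)
        (fun i => if i < d then ε i * ‖A ^ (d - i)‖ else ε i * ‖closedLoop A B R P ^ (i - d)‖)
        ‖closedLoop A B R P ^ (k - d)‖ T w t := by
  set u := myopicControl A B R P d k T x₀ w what with hu
  set F := closedLoop A B R P with hF
  have hut := myopicControl_eq (A := A) (B := B) (R := R) (P := P) d k T x₀ w what t
  rw [myopicAction, if_pos hdk, ← hu, ← hF] at hut
  refine ⟨_, deviation_eq_of_control_eq hut, ?_⟩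
  -- Three sources of error: the estimated state, the predictions used, and the tail of the
  -- feedforward vector.
  have hφ : P *ᵥ A *ᵥ traj A B x₀ w u t + feedforward F P T w t
      - ((P * A) *ᵥ stateEstimate A B d t (traj A B x₀ w u) u (fun s => what s t) t
        + ∑ i ∈ range (min (k - d) (T - t)), (Fᵀ ^ i * P) *ᵥ what (t + i) t)
      = P *ᵥ A *ᵥ (∑ j ∈ Ico (t - d) t, (A ^ (t - 1 - j)) *ᵥ (w j - what j t))
        + ∑ i ∈ range (min (k - d) (T - t)), (Fᵀ ^ i * P) *ᵥ (w (t + i) - what (t + i) t)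
        + (Fᵀ ^ (k - d)) *ᵥ feedforward F P T w (t + (k - d)) := by
    rw [feedforward_eq_sum_add T w t (k - d), ← traj_sub_stateEstimate d t x₀ w _ u t]
    simp only [mulVec_sub, sum_sub_distrib, mulVec_mulVec]
    abel
  rw [hφ, errorBound]
  refine (euNorm_add_le _ _).trans (add_le_add ((euNorm_add_le _ _).trans ?_) ?_)
  · rw [show k = d + (k - d) by omega, sum_range_add, show d + (k - d) - d = k - d by omega]
    refine add_le_add ?_ ?_
    · refine (euNorm_propagated_error_le d ht (e := ε) fun s h1 h2 =>
        hpred t ht s (by omega) (by omega)).trans_eq (sum_congr rfl fun i hi => ?_)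
      rw [if_pos (mem_range.1 hi)]
    · refine (euNorm_sum_le _ _).trans ?_
      refine le_trans (sum_le_sum fun i hi => ?_) (sum_le_sum_of_subset_of_nonneg
        (range_subset_range.2 (min_le_left (k - d) (T - t))) fun i _ _ => ?_)
      · have hi' := mem_range.1 hi
        rw [if_neg (by omega), if_pos (by omega), show d + i - d = i by omega,
          show t + (d + i) - d = t + i by omega, truncNorm, if_pos (by omega), ← mulVec_mulVec]
        have h := hpred t ht (t + i) (by omega) (by omega)
        rw [show t + i + d - t = d + i by omega] at h
        calc _ ≤ ‖F ^ i‖ * (‖P‖ * (ε (d + i) * euNorm (w (t + i)))) := by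
              refine (euNorm_mulVec_le _ _).trans ?_
              rw [← transpose_pow, norm_transpose]
              gcongr
              refine (euNorm_mulVec_le _ _).trans ?_
              gcongr
              exact h
          _ = _ := by ring
      · have := hε (d + i)
        rw [if_neg (by omega), if_pos (by omega)]
        have := truncNorm_nonneg T w (t + (d + i) - d)
        positivity
  · refine (euNorm_mulVec_le _ _).trans_eq ?_
    rw [← transpose_pow, norm_transpose]

/-- Error of the policy when the number of predictions is at most the delay. -/
lemma exists_error_of_le_delay {d k T t : ℕ} (hkd : k ≤ d) (ht : t < T) (x₀ : Fin n → ℝ)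
    {ε : ℕ → ℝ} {w : ℕ → Fin n → ℝ} {what : ℕ → ℕ → Fin n → ℝ}
    (hpred : PredictionErrorBound d T ε w what) :
    ∃ φ : Fin n → ℝ,
      deviation A B R P x₀ T w (myopicControl A B R P d k T x₀ w what) t
        = ((R + Bᵀ * P * B)⁻¹ * Bᵀ) *ᵥ φ ∧
      euNorm φ ≤ errorBound (closedLoop A B R P) P d d 0
        (fun i => (if i < k then ε i else 1) * ‖A ^ (d - i)‖) 1 T w t := by
  set u := myopicControl A B R P d k T x₀ w what with hu
  -- Open-loop propagation amounts to predicting zero from time `t - (d - k)` on, with error `w s`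
  -- itself.
  set v' : ℕ → Fin n → ℝ := fun s => if s + d < t + k then what s t else 0 with hv'
  set x' := stateEstimate A B d t (traj A B x₀ w u) u v' t with hx'
  have hprop := stateEstimate_add (A := A) (B := B) d t (x := traj A B x₀ w u) (u := u)
    (v := fun s => what s t) (v' := v') (p := t - min (d - k) t) (j := min (d - k) t) (by omega)
    (fun s hs => if_pos (by omega)) (fun s hs => if_neg (by omega))
  rw [Nat.sub_add_cancel (min_le_right _ _), ← hx'] at hprop
  have hut : u t = -(((R + Bᵀ * P * B)⁻¹ * Bᵀ) *ᵥ P *ᵥ A *ᵥ x') := by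
    rw [hu, myopicControl_eq, myopicAction, ← hu]
    split_ifs with hdk
    -- At `k = d` the action is defined by the other branch, whose feedforward sum is empty.
    · obtain rfl : d = k := le_antisymm hdk hkd
      rw [hprop]
      simp [mulVec_mulVec]
    · rw [← hprop]
      simp only [mulVec_mulVec, Matrix.mul_assoc]
  refine ⟨_, deviation_eq_of_control_eq hut, ?_⟩
  have hφ : P *ᵥ A *ᵥ traj A B x₀ w u t + feedforward (closedLoop A B R P) P T w t
      - P *ᵥ A *ᵥ x'
      = P *ᵥ A *ᵥ (∑ j ∈ Ico (t - d) t, (A ^ (t - 1 - j)) *ᵥ (w j - v' j))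
        + feedforward (closedLoop A B R P) P T w t := by
    rw [← traj_sub_stateEstimate d t x₀ w v' u t]
    simp only [mulVec_sub, hx']
    abel
  rw [hφ, errorBound, one_mul, add_zero]
  refine (euNorm_add_le _ _).trans (add_le_add_left ?_ _)
  refine euNorm_propagated_error_le d ht fun s h1 h2 => ?_
  by_cases hs : s + d < t + k
  · rw [if_pos (by omega), hv']
    dsimp only
    rw [if_pos hs]
    exact hpred t ht s (by omega) (by omega)
  · rw [if_neg (by omega), hv']
    dsimp only
    rw [if_neg hs, sub_zero, one_mul]

end Policy

end DelayedLQR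

/-! ### The main theorem. -/

theorem mainTheorem1 {n m : ℕ}
    (A : Matrix (Fin n) (Fin n) ℝ) (B : Matrix (Fin n) (Fin m) ℝ)
    (Q : Matrix (Fin n) (Fin n) ℝ) (R : Matrix (Fin m) (Fin m) ℝ)
    (Qf P F H : Matrix (Fin n) (Fin n) ℝ)
    (hQ : Q.PosSemidef) (hQf : Qf.PosSemidef) (hR : R.PosDef)
    (hAB : DelayedLQR.Stabilizable A B) (hAQ : DelayedLQR.Stabilizable Aᵀ Q)
    (hP : DelayedLQR.IsDARESolution A B Q R P)
    (hF : F = DelayedLQR.closedLoop A B R P) (hH : H = DelayedLQR.gainH B R P)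
    (hPinv : IsUnit P)
    (hlam : 0 < DelayedLQR.lambdaMin (P⁻¹ - F * P⁻¹ * Fᵀ - H))
    (c : ℝ) (hc : c = ‖P‖ * ‖P⁻¹‖ * (1 + ‖F‖))
    (x₀ : Fin n → ℝ) (r : ℝ) (d k : ℕ) (ε : ℕ → ℝ) (hε : ∀ i, 0 ≤ ε i) :
    ∃ κ : ℝ, (Qf = P → κ = 0) ∧
      ∀ (T : ℕ) (w : ℕ → Fin n → ℝ) (what : ℕ → ℕ → Fin n → ℝ),
        (∀ t < T, ‖WithLp.toLp 2 (w t)‖ ≤ r) →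
        DelayedLQR.PredictionErrorBound d T ε w what →
        (d ≤ k →
          DelayedLQR.algCost A B Q R Qf P d k x₀ T w what ≤
            ((c * ∑ i ∈ Finset.range d, ε i * ‖A ^ (d - i)‖
                  + c * ∑ i ∈ Finset.Ico d k, ε i * ‖F ^ (i - d)‖ + ‖F ^ (k - d)‖) ^ 2 * ‖H‖
                / DelayedLQR.lambdaMin (P⁻¹ - F * P⁻¹ * Fᵀ - H) + 1)
              * DelayedLQR.optCost A B Q R Qf x₀ T w + κ) ∧
        (k ≤ d →
          DelayedLQR.algCost A B Q R Qf P d k x₀ T w what ≤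
            ((c * ∑ i ∈ Finset.range k, ε i * ‖A ^ (d - i)‖
                  + c * ∑ i ∈ Finset.Ico k d, ‖A ^ (d - i)‖ + 1) ^ 2 * ‖H‖
                / DelayedLQR.lambdaMin (P⁻¹ - F * P⁻¹ * Fᵀ - H) + 1)
              * DelayedLQR.optCost A B Q R Qf x₀ T w + κ) := by
  subst hF hH hc
  have hPd : P.PosDef := hP.posSemidef.posDef_iff_isUnit.2 hPinv
  obtain ⟨κ₁, h₁, hb₁⟩ := DelayedLQR.exists_cost_le hR hPd hP.riccati hlam hQf x₀ r d k (k - d)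
    (a := fun i => if i < d then ε i * ‖A ^ (d - i)‖
      else ε i * ‖DelayedLQR.closedLoop A B R P ^ (i - d)‖)
    (b := ‖DelayedLQR.closedLoop A B R P ^ (k - d)‖)
    (fun i => by have := hε i; split_ifs <;> positivity) (norm_nonneg _)
  -- No feedforward is used here, so all of `v_t` counts as error: `l = 0` and `b = 1`.
  obtain ⟨κ₂, h₂, hb₂⟩ := DelayedLQR.exists_cost_le hR hPd hP.riccati hlam hQf x₀ r d d 0
    (a := fun i => (if i < k then ε i else 1) * ‖A ^ (d - i)‖) (b := 1)
    (fun i => by have := hε i; split_ifs <;> positivity) zero_le_one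
  refine ⟨max κ₁ κ₂, fun h => by rw [h₁ h, h₂ h, max_self], fun T w what hw hpred =>
    ⟨fun hdk => ?_, fun hkd => ?_⟩⟩
  · have h := hb₁ T w _ hw fun t ht =>
      DelayedLQR.exists_error_of_delay_le hdk ht x₀ hε hpred
    rw [← sum_range_add_sum_Ico _ hdk, mul_add,
      sum_congr rfl fun i hi => if_pos (mem_range.1 hi),
      sum_congr (s₁ := Ico d k) rfl fun i hi => if_neg (not_lt.2 (mem_Ico.1 hi).1)] at h
    exact h.trans (add_le_add_right (le_max_left _ _) _)
  · have h := hb₂ T w _ hw fun t ht =>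
      DelayedLQR.exists_error_of_le_delay hkd ht x₀ hpred
    rw [← sum_range_add_sum_Ico _ hkd, mul_add,
      sum_congr (s₁ := range k) rfl fun i hi => by rw [if_pos (mem_range.1 hi)],
      sum_congr (s₁ := Ico k d) rfl fun i hi => by
        rw [if_neg (not_lt.2 (mem_Ico.1 hi).1), one_mul]] at h
    exact h.trans (add_le_add_right (le_max_right _ _) _)
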